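/- Let $(R,\mathfrak m)$ be a commutative Noetherian local ring of prime characteristic $p>0$ and of Krull dimension $d>0$. For an $R$-module $M$ let $H^i_{\mathfrak m}(M)$ be the $i$-th local cohomology module, computed as the $i$-th cohomology of the \v{C}ech complex of $M$ on any finite sequence of elements of $R$ generating an ideal with radical $\mathfrak m$. For $e\ge 0$ and an ideal $I\subseteq R$ let $I^{[p^e]}$ be the ideal generated by all $a^{p^e}$ with $a\in I$. The map $a\mapsto a^{p^e}$ on $R$ induces $F^e:H^i_{\mathfrak m}(R)\to H^i_{\mathfrak m}(R)$, and the map $R/I\to R/I^{[p^e]}$, $a+I\mapsto a^{p^e}+I^{[p^e]}$, induces $F^e_R:H^i_{\mathfrak m}(R/I)\to H^i_{\mathfrak m}(R/I^{[p^e]})$. We say that $H^i_{\mathfrak m}(R)$ is $F$-nilpotent if for every $\eta\in H^i_{\mathfrak m}(R)$ there is an $e$ with $F^e(\eta)=0$, and that $H^i_{\mathfrak m}(R/I)$ is $F$-nilpotent with respect to $R$ if for every $\eta\in H^i_{\mathfrak m}(R/I)$ there is an $e$ with $F^e_R(\eta)=0$ in $H^i_{\mathfrak m}(R/I^{[p^e]})$.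 An element $x\in\mathfrak m$ is filter regular if $x\notin\mathfrak p$ for every associated prime $\mathfrak p\neq\mathfrak m$ of $R$. Then for every integer $t$ the following are equivalent: \begin{enumerate} \item $H^i_{\mathfrak m}(R)$ is $F$-nilpotent for all $i\le t$. \item For every filter regular element $x$, $H^i_{\mathfrak m}(R/(x))$ is $F$-nilpotent with respect to $R$ for all $i\le t-1$. \item There exists a filter regular element $x$ such that for all $n\ge 1$, $H^i_{\mathfrak m}(R/(x^n))$ is $F$-nilpotent with respect to $R$ for all $i\le t-1$. \item There exists a filter regular element $x$ such that for all $e\ge 0$, $H^i_{\mathfrak m}(R/(x^{p^e}))$ is $F$-nilpotent with respect to $R$ for all $i\le t-1$. \end{enumerate} -/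

import Mathlib

noncomputable section

namespace LocalCoh

variable {R : Type*} [CommRing R]

/-! ### Local cohomology through the Čech complex -/

section Cech

variable {n : ℕ} (s : Fin n → R)
variable (M : Type*) [AddCommGroup M] [Module R M]

/-- The localization `M_f` of an `R`-module at an element `f : R`. -/
abbrev Loc (f : R) : Type _ := LocalizedModule (Submonoid.powers f) M

lemma isUnit_of_dvd {f g : R} (h : f ∣ g) (a : Submonoid.powers f) :
    IsUnit (algebraMap R (Module.End R (Loc M g)) a) := by
  obtain ⟨_, k, rfl⟩ := a
  obtain ⟨c, rfl⟩ := h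
  have hu : IsUnit (algebraMap R (Module.End R (Loc M (f * c))) (f * c)) :=
    IsLocalizedModule.map_units (LocalizedModule.mkLinearMap (Submonoid.powers (f * c)) M)
      ⟨f * c, Submonoid.mem_powers _⟩
  rw [map_mul, (Algebra.commute_algebraMap_left _ _).isUnit_mul_iff] at hu
  simpa using hu.1.pow k

/-- The canonical map `M_f → M_g` for `f ∣ g`, the one under `M`. -/
def locMap {f g : R} (h : f ∣ g) : Loc M f →ₗ[R] Loc M g :=
  LocalizedModule.lift (Submonoid.powers f)
    (LocalizedModule.mkLinearMap (Submonoid.powers g) M) (isUnit_of_dvd M h)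

/-- The product `s_{σ 0} ⋯ s_{σ (k-1)}`. -/
def prodAt {k : ℕ} (σ : Fin k ↪o Fin n) : R := ∏ j, s (σ j)

/-- `σ` with its `j`-th entry left out. -/
def face {k : ℕ} (σ : Fin (k + 1) ↪o Fin n) (j : Fin (k + 1)) : Fin k ↪o Fin n :=
  (Fin.succAboveOrderEmb j).trans σ

lemma prodAt_face_dvd {k : ℕ} (σ : Fin (k + 1) ↪o Fin n) (j : Fin (k + 1)) :
    prodAt s (face σ j) ∣ prodAt s σ :=
  ⟨s (σ j), by rw [prodAt, Fin.prod_univ_succAbove _ j, mul_comm]; rfl⟩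

/-- The degree `k` term `⨁_{i₁ < ⋯ < i_k} M_{s_{i₁} ⋯ s_{i_k}}` of the Čech complex. -/
abbrev Cochain (k : ℕ) : Type _ := ∀ σ : Fin k ↪o Fin n, Loc M (prodAt s σ)

/-- The Čech differential: the alternating sum of the localization maps. -/
def diff (k : ℕ) : Cochain s M k →ₗ[R] Cochain s M (k + 1) where
  toFun c σ := ∑ j : Fin (k + 1),
    (-1 : R) ^ (j : ℕ) • locMap M (prodAt_face_dvd s σ j) (c (face σ j))
  map_add' c c' := by
    ext σ
    simp only [Pi.add_apply, map_add, smul_add, Finset.sum_add_distrib]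
  map_smul' r c := by
    ext σ
    simp only [Pi.smul_apply, map_smul, RingHom.id_apply, Finset.smul_sum]
    exact Finset.sum_congr rfl fun j _ => smul_comm _ _ _

lemma locMap_locMap {f g h : R} (a : f ∣ g) (b : g ∣ h) (y : Loc M f) :
    locMap M b (locMap M a y) = locMap M (a.trans b) y := by
  have : locMap M b ∘ₗ locMap M a = locMap M (a.trans b) := by
    symm
    apply LocalizedModule.lift_unique
    ext m
    simp only [LinearMap.comp_apply, locMap, LocalizedModule.mkLinearMap_apply,
      LocalizedModule.lift_mk_one]
  exact congr($this y)

/-- The Čech complex is a complex. -/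
lemma diff_diff (k : ℕ) (c : Cochain s M k) : diff s M (k + 1) (diff s M k c) = 0 := by
  ext σ
  have hdvd (j : Fin (k + 2)) (i : Fin (k + 1)) : prodAt s (face (face σ j) i) ∣ prodAt s σ :=
    (prodAt_face_dvd s (face σ j) i).trans (prodAt_face_dvd s σ j)
  have h1 (j : Fin (k + 2)) : (-1 : R) ^ (j : ℕ) • ∑ i : Fin (k + 1),
      locMap M (prodAt_face_dvd s σ j) ((-1 : R) ^ (i : ℕ) •
        locMap M (prodAt_face_dvd s (face σ j) i) (c (face (face σ j) i))) =
      ∑ i : Fin (k + 1), (-1 : R) ^ (j + i : ℕ) •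
        locMap M (hdvd j i) (c (face (face σ j) i)) := by
    rw [Finset.smul_sum]
    refine Finset.sum_congr rfl fun i _ => ?_
    rw [map_smul, locMap_locMap, pow_add, mul_smul]
  simp only [diff, LinearMap.coe_mk, AddHom.coe_mk, map_sum, Pi.zero_apply]
  refine (Finset.sum_congr rfl fun j _ => h1 j).trans ?_
  rw [← Finset.univ.sum_product' Finset.univ (fun (j : Fin (k + 2)) (i : Fin (k + 1)) =>
    (-1 : R) ^ (j + i : ℕ) • locMap M (hdvd j i) (c (face (face σ j) i)))]
  refine Finset.sum_involution (fun a _ => (a.1.succAbove a.2, a.2.predAbove a.1)) ?_ ?_ ?_ ?_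
  · rintro ⟨j, i⟩ -
    have hf : face (face σ (j.succAbove i)) (i.predAbove j) = face (face σ j) i := by
      ext x
      simp [face, Fin.succAbove_succAbove_succAbove_predAbove]
    have key : ∀ τ τ' : Fin k ↪o Fin n, ∀ (h : prodAt s τ ∣ prodAt s σ)
        (h' : prodAt s τ' ∣ prodAt s σ), τ = τ' → locMap M h (c τ) = locMap M h' (c τ') := by
      rintro τ _ h h' rfl
      rfl
    simp only [Fin.neg_one_pow_succAbove_add_predAbove]
    rw [key _ _ _ (hdvd j i) hf, neg_smul, add_neg_cancel]
  · rintro ⟨j, i⟩ - - h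
    simp only [Prod.mk.injEq] at h
    exact Fin.succAbove_ne _ _ h.1
  · simp
  · rintro ⟨j, i⟩ -
    simp [Fin.succAbove_succAbove_predAbove, Fin.predAbove_predAbove_succAbove]

/-- The cocycles of degree `i`. -/
abbrev cocycles (i : ℕ) : Submodule R (Cochain s M i) := LinearMap.ker (diff s M i)

/-- The coboundaries of degree `i`; there are none but `0` in degree `0`. -/
def coboundaries : (i : ℕ) → Submodule R (Cochain s M i)
  | 0 => ⊥
  | i + 1 => LinearMap.range (diff s M i)

/-- The `i`-th local cohomology module of `M`, supported at any ideal with the same radical as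
`(s_0, …, s_{n-1})`: the `i`-th cohomology of the Čech complex
`0 → M → ⨁ M_{s_i} → ⋯ → M_{s_0 ⋯ s_{n-1}} → 0`. -/
abbrev LocalCohomology (i : ℕ) : Type _ :=
  cocycles s M i ⧸ (coboundaries s M i).submoduleOf (cocycles s M i)

end Cech

/-! ### Maps induced by Frobenius-semilinear maps -/

section Frobenius

variable {p e : ℕ} [ExpChar R p]
variable {M N : Type*} [AddCommGroup M] [Module R M] [AddCommGroup N] [Module R N]

/-- The map `M_f → N_f`, `m / f^k ↦ φ m / f^(k p^e)`, induced by a map `φ : M → N` that is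
semilinear for the `e`-th iterate of Frobenius. -/
def locFrob (φ : M →ₛₗ[iterateFrobenius R p e] N) (f : R) :
    Loc M f →ₛₗ[iterateFrobenius R p e] Loc N f where
  toFun y := LocalizedModule.liftOn y (fun a => LocalizedModule.mk (φ a.1) (a.2 ^ p ^ e)) (by
    rintro ⟨m, a⟩ ⟨m', a'⟩ ⟨u, hu⟩
    refine LocalizedModule.mk_eq.2 ⟨u ^ p ^ e, ?_⟩
    have h := congrArg φ hu
    simp only [Submonoid.smul_def, map_smulₛₗ, iterateFrobenius_def] at h
    simpa only [Submonoid.smul_def, SubmonoidClass.coe_pow] using h)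
  map_add' x y := by
    induction x, y using LocalizedModule.induction_on₂ with
    | h m m' a a' =>
      rw [LocalizedModule.mk_add_mk, LocalizedModule.liftOn_mk, LocalizedModule.liftOn_mk,
        LocalizedModule.liftOn_mk, LocalizedModule.mk_add_mk, mul_pow]
      simp only [Submonoid.smul_def, map_add, map_smulₛₗ, iterateFrobenius_def,
        SubmonoidClass.coe_pow]
  map_smul' r x := by
    induction x using LocalizedModule.induction_on with
    | h m a =>
      rw [LocalizedModule.smul'_mk, LocalizedModule.liftOn_mk, LocalizedModule.liftOn_mk,
        LocalizedModule.smul'_mk, map_smulₛₗ]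

lemma locFrob_mk (φ : M →ₛₗ[iterateFrobenius R p e] N) (f : R) (m : M)
    (a : Submonoid.powers f) :
    locFrob φ f (LocalizedModule.mk m a) = LocalizedModule.mk (φ m) (a ^ p ^ e) :=
  rfl

lemma locMap_locFrob (φ : M →ₛₗ[iterateFrobenius R p e] N) {f g : R} (h : f ∣ g) (y : Loc M f) :
    locMap N h (locFrob φ f y) = locFrob φ g (locMap M h y) := by
  induction y using LocalizedModule.induction_on with
  | h m a =>
    have hinj := ((Module.End.isUnit_iff _).1 (isUnit_of_dvd N h (a ^ p ^ e))).1
    apply hinj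
    simp only [Module.algebraMap_end_apply]
    have e1 : ((a ^ p ^ e : Submonoid.powers f) : R) • locFrob φ f (LocalizedModule.mk m a) =
        LocalizedModule.mk (φ m) 1 := by
      rw [locFrob_mk, LocalizedModule.smul'_mk]
      exact LocalizedModule.mk_cancel _ _
    have e2 : (a : R) • (LocalizedModule.mk m a : Loc M f) = LocalizedModule.mk m 1 := by
      rw [LocalizedModule.smul'_mk]
      exact LocalizedModule.mk_cancel _ _
    have e3 : ((a ^ p ^ e : Submonoid.powers f) : R) •
        locFrob φ g (locMap M h (LocalizedModule.mk m a)) =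
        locFrob φ g (locMap M h (LocalizedModule.mk m 1)) := by
      rw [← e2, map_smul, map_smulₛₗ, iterateFrobenius_def, SubmonoidClass.coe_pow]
    rw [← map_smul, e1, e3, locMap, locMap, LocalizedModule.lift_mk_one,
      LocalizedModule.lift_mk_one, LocalizedModule.mkLinearMap_apply,
      LocalizedModule.mkLinearMap_apply, locFrob_mk, one_pow]

variable {n : ℕ} (s : Fin n → R)

/-- The map of Čech cochains induced by `φ`, term by term. -/
def cochainFrob (φ : M →ₛₗ[iterateFrobenius R p e] N) (k : ℕ) :
    Cochain s M k →ₛₗ[iterateFrobenius R p e] Cochain s N k where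
  toFun c σ := locFrob φ _ (c σ)
  map_add' c c' := by ext σ; simp
  map_smul' r c := by ext σ; simp

lemma diff_cochainFrob (φ : M →ₛₗ[iterateFrobenius R p e] N) (k : ℕ) (c : Cochain s M k) :
    diff s N k (cochainFrob s φ k c) = cochainFrob s φ (k + 1) (diff s M k c) := by
  ext σ
  simp only [diff, cochainFrob, LinearMap.coe_mk, AddHom.coe_mk, map_sum, locMap_locFrob,
    map_smulₛₗ, map_pow, map_neg, map_one]

lemma cochainFrob_mem_cocycles (φ : M →ₛₗ[iterateFrobenius R p e] N) (i : ℕ)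
    (c : cocycles s M i) : cochainFrob s φ i c ∈ cocycles s N i := by
  rw [LinearMap.mem_ker, diff_cochainFrob, LinearMap.mem_ker.1 c.2, map_zero]

/-- The map of cocycles induced by `φ`. -/
def cocyclesFrob (φ : M →ₛₗ[iterateFrobenius R p e] N) (i : ℕ) :
    cocycles s M i →ₛₗ[iterateFrobenius R p e] cocycles s N i :=
  ((cochainFrob s φ i).comp (cocycles s M i).subtype).codRestrict (cocycles s N i)
    (cochainFrob_mem_cocycles s φ i)

lemma cochainFrob_mem_coboundaries (φ : M →ₛₗ[iterateFrobenius R p e] N) (i : ℕ)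
    {c : Cochain s M i} (hc : c ∈ coboundaries s M i) :
    cochainFrob s φ i c ∈ coboundaries s N i := by
  cases i with
  | zero =>
    obtain rfl : c = 0 := hc
    rw [map_zero]
    exact zero_mem _
  | succ i =>
    obtain ⟨b, rfl⟩ := hc
    exact ⟨cochainFrob s φ i b, diff_cochainFrob s φ i b⟩

/-- The map `H^i(M) → H^i(N)` induced by `φ`. -/
def cohomologyFrob (φ : M →ₛₗ[iterateFrobenius R p e] N) (i : ℕ) :
    LocalCohomology s M i →ₛₗ[iterateFrobenius R p e] LocalCohomology s N i :=
  Submodule.mapQ _ _ (cocyclesFrob s φ i)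
    fun _ hc => cochainFrob_mem_coboundaries s φ i hc

end Frobenius

/-! ### `F`-nilpotence -/

section Nilpotent

variable (p : ℕ) [ExpChar R p]

/-- The Frobenius power `I^[p^e]`: the expansion of `I` along `F^e : R → R`. -/
def frobeniusPower (I : Ideal R) (e : ℕ) : Ideal R := I.map (iterateFrobenius R p e)

/-- `F_R^e : R/I → R/I^[p^e]`, `a + I ↦ a^(p^e) + I^[p^e]`. -/
def relFrobenius (I : Ideal R) (e : ℕ) :
    (R ⧸ I) →ₛₗ[iterateFrobenius R p e] (R ⧸ frobeniusPower p I e) :=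
  Submodule.mapQ I (frobeniusPower p I e) (iterateFrobenius R p e).toSemilinearMap
    fun _ ha => Ideal.mem_map_of_mem _ ha

variable {n : ℕ} (s : Fin n → R)

/-- `H^i(R)` is `F`-nilpotent: every element is killed by an iterate of the Frobenius action
`F^e : H^i(R) → H^i(R)` induced by `F^e : R → R`. -/
def FNilpotent (i : ℕ) : Prop :=
  ∀ η : LocalCohomology s R i, ∃ e : ℕ,
    cohomologyFrob s (iterateFrobenius R p e).toSemilinearMap i η = 0

/-- `H^i(R/I)` is `F`-nilpotent with respect to `R`: every element is killed by
`F_R^e : H^i(R/I) → H^i(R/I^[p^e])` for some `e`. -/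
def RelFNilpotent (I : Ideal R) (i : ℕ) : Prop :=
  ∀ η : LocalCohomology s (R ⧸ I) i, ∃ e : ℕ,
    cohomologyFrob s (relFrobenius p I e) i η = 0

end Nilpotent

/-- `x` is a filter regular element of the local ring `R`. -/
def IsFilterRegular [IsLocalRing R] (x : R) : Prop :=
  x ∈ IsLocalRing.maximalIdeal R ∧
    ∀ P ∈ associatedPrimes R R, P ≠ IsLocalRing.maximalIdeal R → x ∉ P

end LocalCoh

end

/-! For filter regular x the kernel of multiplication by x is 𝔪-power torsion, so it dies in every
localization occurring in positive Čech degree (`smul_cochain_injective`). Hence the long exact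
sequence of R --x→ R → R/(x) can be chased on cochains, and Frobenius carries it to the sequence of
x^(p^e), since F^e(x a) = x^(p^e) F^e(a).

(1) ⇒ (2): for a class of H^i(R/(x)), Frobenius first kills its image in H^{i+1}(R), then the class
of H^i(R) that it now comes from (`relFNilpotent_of_fNilpotent`). (4) ⇒ (1): inverting some s_j
makes the Čech complex exact, so classes are killed by powers of x
(`exists_pow_smul_mem_coboundaries_of_mem_radical`); a class of H^{i+1}(R) thus comes from some
H^i(R/(x^(p^N))), where Frobenius kills it (`fNilpotent_succ_of_relFNilpotent`). H^0(R) is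
F-nilpotent outright in positive dimension (`fNilpotent_zero`), and prime avoidance supplies x for
(2) ⇒ (3). -/

noncomputable section

namespace LocalCoh

/-! ### Localization of modules at one element -/

section Localization

variable {R : Type*} [CommRing R]
variable {M N : Type*} [AddCommGroup M] [Module R M] [AddCommGroup N] [Module R N]

lemma mk_eq_zero_iff {S : Submonoid R} (m : M) (a : S) :
    (LocalizedModule.mk m a : LocalizedModule S M) = 0 ↔ ∃ u : S, (u : R) • m = 0 := by
  rw [← LocalizedModule.zero_mk a, LocalizedModule.mk_eq]
  constructor
  · rintro ⟨u, hu⟩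
    refine ⟨u * a, ?_⟩
    simpa [Submonoid.smul_def, mul_smul] using hu
  · rintro ⟨u, hu⟩
    refine ⟨u, ?_⟩
    rw [smul_comm]
    simp [Submonoid.smul_def, hu]

lemma coe_smul_mk {S : Submonoid R} (m : M) (a : S) :
    (a : R) • (LocalizedModule.mk m a : LocalizedModule S M) = LocalizedModule.mk m 1 := by
  rw [LocalizedModule.smul'_mk]
  exact LocalizedModule.mk_cancel _ _

/-- The map `M_f → N_f` induced by a linear map `M → N`. -/
def locLin (φ : M →ₗ[R] N) (f : R) : Loc M f →ₗ[R] Loc N f :=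
  IsLocalizedModule.map (Submonoid.powers f) (LocalizedModule.mkLinearMap _ M)
    (LocalizedModule.mkLinearMap _ N) φ

@[simp]
lemma locLin_mk (φ : M →ₗ[R] N) (f : R) (m : M) (a : Submonoid.powers f) :
    locLin φ f (LocalizedModule.mk m a) = LocalizedModule.mk (φ m) a :=
  IsLocalizedModule.map_LocalizedModules _ _ _ _

lemma locMap_mk_one {f g : R} (h : f ∣ g) (m : M) :
    locMap M h (LocalizedModule.mk m 1) = LocalizedModule.mk m 1 := by
  rw [locMap, LocalizedModule.lift_mk_one, LocalizedModule.mkLinearMap_apply]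

/-- Multiplication by f^k is invertible on M_g, and it turns both sides into m/1. -/
lemma locMap_mk {f g u : R} (hg : g = f * u) (h : f ∣ g) (m : M) (k : ℕ) :
    locMap M h (LocalizedModule.mk m ⟨f ^ k, k, rfl⟩) =
      (LocalizedModule.mk (u ^ k • m) ⟨g ^ k, k, rfl⟩ : Loc M g) := by
  apply ((Module.End.isUnit_iff _).1 (isUnit_of_dvd M h ⟨f ^ k, k, rfl⟩)).1
  simp only [Module.algebraMap_end_apply]
  have h1 : f ^ k • (LocalizedModule.mk m ⟨f ^ k, k, rfl⟩ : Loc M f) = LocalizedModule.mk m 1 :=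
    coe_smul_mk (S := Submonoid.powers f) m ⟨f ^ k, k, rfl⟩
  have h2 : g ^ k • (LocalizedModule.mk m ⟨g ^ k, k, rfl⟩ : Loc M g) = LocalizedModule.mk m 1 :=
    coe_smul_mk (S := Submonoid.powers g) m ⟨g ^ k, k, rfl⟩
  rw [← map_smul, h1, locMap_mk_one, ← LocalizedModule.smul'_mk, smul_smul, ← mul_pow, ← hg, h2]

lemma locMap_locLin (φ : M →ₗ[R] N) {f g : R} (h : f ∣ g) (y : Loc M f) :
    locMap N h (locLin φ f y) = locLin φ g (locMap M h y) := by
  obtain ⟨u, hu⟩ := id h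
  induction y using LocalizedModule.induction_on with
  | h m a =>
    obtain ⟨_, k, rfl⟩ := a
    rw [locLin_mk, locMap_mk hu, locMap_mk hu, locLin_mk, map_smul]

lemma locLin_surjective {φ : M →ₗ[R] N} (hφ : Function.Surjective φ) (f : R) :
    Function.Surjective (locLin φ f) := by
  intro y
  induction y using LocalizedModule.induction_on with
  | h m a =>
    obtain ⟨m, rfl⟩ := hφ m
    exact ⟨LocalizedModule.mk m a, locLin_mk _ _ _ _⟩

/-- If `u` acts bijectively on `M`, then `M_f → M_{f u}` is bijective. -/
lemma locMap_bijective {f g u : R} (hg : g = f * u) (h : f ∣ g)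
    (hu : Function.Bijective fun m : M => u • m) : Function.Bijective (locMap M h) := by
  have hpow (k : ℕ) : Function.Bijective fun m : M => u ^ k • m := by
    have : (fun m : M => u ^ k • m) = (fun m : M => u • m)^[k] := by
      ext m
      rw [smul_iterate]
    rw [this]
    exact hu.iterate k
  constructor
  · rw [injective_iff_map_eq_zero]
    intro y hy
    induction y using LocalizedModule.induction_on with
    | h m a =>
      obtain ⟨_, k, rfl⟩ := a
      rw [locMap_mk hg, mk_eq_zero_iff] at hy
      obtain ⟨⟨_, l, rfl⟩, hl⟩ := hy
      refine (mk_eq_zero_iff _ _).2 ⟨⟨f ^ l, l, rfl⟩, (hpow (l + k)).1 ?_⟩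
      simp only [smul_zero]
      rw [← hl, hg, smul_smul, smul_smul]
      congr 1
      ring
  · intro y
    induction y using LocalizedModule.induction_on with
    | h m a =>
      obtain ⟨_, k, rfl⟩ := a
      obtain ⟨m, rfl⟩ := (hpow k).2 m
      exact ⟨LocalizedModule.mk m ⟨f ^ k, k, rfl⟩, locMap_mk hg h m k⟩

/-- `M_f → (M_u)_f` is a localization at `u`: elements of the kernel are killed by a power
of `u`. -/
lemma exists_pow_smul_eq_zero_of_locLin_mkLinearMap (f u : R) (y : Loc M f)
    (hy : locLin (LocalizedModule.mkLinearMap (Submonoid.powers u) M) f y = 0) :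
    ∃ k : ℕ, u ^ k • y = 0 := by
  induction y using LocalizedModule.induction_on with
  | h m a =>
    rw [locLin_mk, mk_eq_zero_iff] at hy
    obtain ⟨v, hv⟩ := hy
    rw [LocalizedModule.mkLinearMap_apply, LocalizedModule.smul'_mk, mk_eq_zero_iff] at hv
    obtain ⟨⟨_, k, rfl⟩, hk⟩ := hv
    refine ⟨k, ?_⟩
    rw [LocalizedModule.smul'_mk, mk_eq_zero_iff]
    exact ⟨v, by rw [smul_comm]; exact hk⟩

/-- `M_f → (M_u)_f` is a localization at `u`: up to a power of `u`, it is surjective. -/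
lemma exists_locLin_mkLinearMap_eq_pow_smul (f u : R) (y : Loc (Loc M u) f) :
    ∃ k : ℕ, ∃ z : Loc M f,
      locLin (LocalizedModule.mkLinearMap (Submonoid.powers u) M) f z = u ^ k • y := by
  induction y using LocalizedModule.induction_on with
  | h w a =>
    induction w using LocalizedModule.induction_on with
    | h m b =>
      obtain ⟨_, k, rfl⟩ := b
      refine ⟨k, LocalizedModule.mk m a, ?_⟩
      rw [locLin_mk, LocalizedModule.smul'_mk, LocalizedModule.mkLinearMap_apply]
      congr 1
      exact (coe_smul_mk (S := Submonoid.powers u) m ⟨u ^ k, k, rfl⟩).symm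

end Localization

/-! ### Linear maps on cochains; multiplication by x -/

section Cochains

variable {R : Type*} [CommRing R] {n : ℕ} (s : Fin n → R)
variable {M N : Type*} [AddCommGroup M] [Module R M] [AddCommGroup N] [Module R N]

/-- The map of Čech cochains induced by a linear map. -/
def cochainMap (φ : M →ₗ[R] N) (k : ℕ) : Cochain s M k →ₗ[R] Cochain s N k where
  toFun c σ := locLin φ _ (c σ)
  map_add' c c' := by ext σ; simp
  map_smul' r c := by ext σ; simp

lemma diff_cochainMap (φ : M →ₗ[R] N) (k : ℕ) (c : Cochain s M k) :
    diff s N k (cochainMap s φ k c) = cochainMap s φ (k + 1) (diff s M k c) := by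
  ext σ
  simp only [diff, cochainMap, LinearMap.coe_mk, AddHom.coe_mk, map_sum, locMap_locLin, map_smul]

lemma cochainMap_surjective {φ : M →ₗ[R] N} (hφ : Function.Surjective φ) (k : ℕ) :
    Function.Surjective (cochainMap s φ k) := by
  intro c
  choose b hb using fun σ => locLin_surjective hφ (prodAt s σ) (c σ)
  exact ⟨b, funext hb⟩

variable {s}

lemma diff_eq_zero_of_mem_coboundaries {i : ℕ} {c : Cochain s M i}
    (hc : c ∈ coboundaries s M i) : diff s M i c = 0 := by
  cases i with
  | zero =>
    obtain rfl : c = 0 := hc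
    exact map_zero _
  | succ i =>
    obtain ⟨b, rfl⟩ := hc
    exact diff_diff s M i b

lemma cochainMap_mem_coboundaries (φ : M →ₗ[R] N) {i : ℕ} {c : Cochain s M i}
    (hc : c ∈ coboundaries s M i) : cochainMap s φ i c ∈ coboundaries s N i := by
  cases i with
  | zero =>
    obtain rfl : c = 0 := hc
    rw [map_zero]
    exact zero_mem _
  | succ i =>
    obtain ⟨b, rfl⟩ := hc
    exact ⟨cochainMap s φ i b, diff_cochainMap s φ i b⟩

/-- It is the primitive that gets lifted: an arbitrary lift of a coboundary need not even be a
cocycle. -/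
lemma exists_mem_coboundaries_cochainMap_eq {φ : M →ₗ[R] N} (hφ : Function.Surjective φ) {i : ℕ}
    {c : Cochain s N i} (hc : c ∈ coboundaries s N i) :
    ∃ w ∈ coboundaries s M i, cochainMap s φ i w = c := by
  cases i with
  | zero =>
    obtain rfl : c = 0 := hc
    exact ⟨0, zero_mem _, map_zero _⟩
  | succ i =>
    obtain ⟨b, rfl⟩ := hc
    obtain ⟨w, rfl⟩ := cochainMap_surjective s hφ i b
    exact ⟨_, ⟨w, rfl⟩, (diff_cochainMap s φ i w).symm⟩

/-- The kernel of `C(R) → C(R/(x))` consists of the multiples of `x`. -/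
lemma exists_eq_smul_of_cochainMap_mkQ_eq_zero {I : Ideal R} {x : R} (hI : I = Ideal.span {x})
    {k : ℕ} {c : Cochain s R k} (hc : cochainMap s I.mkQ k c = 0) :
    ∃ g : Cochain s R k, c = x • g := by
  have key (σ : Fin k ↪o Fin n) : ∃ z, c σ = x • z := by
    have hσ : locLin I.mkQ _ (c σ) = 0 := congrFun hc σ
    generalize c σ = y at hσ
    induction y using LocalizedModule.induction_on with
    | h r a =>
      rw [locLin_mk, mk_eq_zero_iff] at hσ
      obtain ⟨v, hv⟩ := hσ
      rw [← map_smul, Submodule.mkQ_apply, Submodule.Quotient.mk_eq_zero, hI,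
        Ideal.mem_span_singleton'] at hv
      obtain ⟨g, hg⟩ := hv
      refine ⟨LocalizedModule.mk g (v * a), ?_⟩
      rw [LocalizedModule.smul'_mk, smul_eq_mul, mul_comm x, hg]
      exact (LocalizedModule.mk_cancel_common_left v a r).symm
  choose g hg using key
  exact ⟨g, funext hg⟩

lemma cochainMap_mkQ_smul_eq_zero {I : Ideal R} {x : R} (hx : x ∈ I) {k : ℕ}
    (c : Cochain s R k) : cochainMap s I.mkQ k (x • c) = 0 := by
  ext σ
  change locLin I.mkQ _ (x • c σ) = 0
  generalize c σ = y
  induction y using LocalizedModule.induction_on with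
  | h r a =>
    have : I.mkQ (x • r) = 0 := by
      rw [Submodule.mkQ_apply, Submodule.Quotient.mk_eq_zero]
      exact I.mul_mem_right _ hx
    rw [LocalizedModule.smul'_mk, locLin_mk, this, LocalizedModule.zero_mk]

/-- If the kernel of multiplication by `x` is torsion, then `x` is injective on cochains of
positive degree. -/
lemma smul_cochain_injective {x : R}
    (hx : ∀ m : M, x • m = 0 → ∀ j, ∃ k : ℕ, s j ^ k • m = 0) {k : ℕ} {c c' : Cochain s M (k + 1)}
    (h : x • c = x • c') : c = c' := by
  rw [← sub_eq_zero] at h ⊢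
  rw [← smul_sub] at h
  ext σ
  have hσ : x • (c - c') σ = 0 := congrFun h σ
  change (c - c') σ = 0
  generalize (c - c') σ = y at hσ
  induction y using LocalizedModule.induction_on with
  | h m a =>
    rw [LocalizedModule.smul'_mk, mk_eq_zero_iff] at hσ
    obtain ⟨⟨_, l, rfl⟩, hl⟩ := hσ
    simp only at hl
    -- Positive degree is what provides the index σ 0; inverting s (σ 0) removes the torsion.
    obtain ⟨N, hN⟩ := hx (prodAt s σ ^ l • m) (by rw [smul_comm]; exact hl) (σ 0)
    obtain ⟨c, hc⟩ : s (σ 0) ∣ prodAt s σ := Finset.dvd_prod_of_mem (fun j => s (σ j))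
      (Finset.mem_univ 0)
    refine (mk_eq_zero_iff _ _).2 ⟨⟨prodAt s σ ^ (N + l), N + l, rfl⟩, ?_⟩
    simp only
    rw [pow_add, mul_smul]
    nth_rewrite 1 [hc]
    rw [mul_pow, mul_comm, mul_smul, hN, smul_zero]

end Cochains

/-! ### Inserting an index into an increasing tuple -/

section Insertion

variable {n : ℕ}

lemma range_eq_insert_face {k : ℕ} (σ : Fin (k + 1) ↪o Fin n) (a : Fin (k + 1)) :
    Set.range σ = insert (σ a) (Set.range (face σ a)) := by
  ext x
  constructor
  · rintro ⟨b, rfl⟩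
    by_cases hb : b = a
    · exact Or.inl (by rw [hb])
    · obtain ⟨i, rfl⟩ := Fin.exists_succAbove_eq hb
      exact Or.inr ⟨i, rfl⟩
  · rintro (rfl | ⟨i, rfl⟩)
    · exact ⟨a, rfl⟩
    · exact ⟨a.succAbove i, rfl⟩

lemma apply_notMem_range_face {k : ℕ} (σ : Fin (k + 1) ↪o Fin n) (a : Fin (k + 1)) :
    σ a ∉ Set.range (face σ a) := by
  rintro ⟨i, hi⟩
  exact Fin.succAbove_ne a i (σ.injective hi)

/-- An increasing tuple is determined by its range, so there is only one way to insert a given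
index. -/
lemma eq_of_face_eq {k : ℕ} {σ τ : Fin (k + 1) ↪o Fin n} {a b : Fin (k + 1)}
    (hab : σ a = τ b) (h : face σ a = face τ b) : σ = τ ∧ a = b := by
  have : σ = τ := by
    rw [← OrderEmbedding.range_inj, range_eq_insert_face σ a, range_eq_insert_face τ b, hab, h]
  subst this
  exact ⟨rfl, σ.injective hab⟩

lemma exists_face_eq {k : ℕ} (τ : Fin k ↪o Fin n) {j : Fin n} (hj : j ∉ Set.range τ) :
    ∃ (σ : Fin (k + 1) ↪o Fin n) (a : Fin (k + 1)), σ a = j ∧ face σ a = τ := by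
  classical
  let A : Finset (Fin n) := Finset.univ.map τ.toEmbedding
  have hA : (A : Set (Fin n)) = Set.range τ := by simp [A]
  have hjA : j ∉ A := by rwa [← Finset.mem_coe, hA]
  have hcard : (insert j A).card = k + 1 := by
    rw [Finset.card_insert_of_notMem hjA, Finset.card_map, Finset.card_univ, Fintype.card_fin]
  have hr : Set.range ((insert j A).orderEmbOfFin hcard) = insert j (Set.range τ) := by
    rw [Finset.range_orderEmbOfFin, Finset.coe_insert, hA]
  obtain ⟨a, ha⟩ : j ∈ Set.range ((insert j A).orderEmbOfFin hcard) := by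
    rw [hr]
    exact Set.mem_insert _ _
  refine ⟨_, a, ha, ?_⟩
  have h := range_eq_insert_face ((insert j A).orderEmbOfFin hcard) a
  have hn := apply_notMem_range_face ((insert j A).orderEmbOfFin hcard) a
  rw [ha] at h hn
  rw [hr] at h
  rw [← OrderEmbedding.range_inj, ← Set.insert_sdiff_self_of_notMem hn, ← h,
    Set.insert_sdiff_self_of_notMem hj]

lemma face_succAbove_predAbove {k : ℕ} (σ : Fin (k + 2) ↪o Fin n) (a : Fin (k + 2))
    (i : Fin (k + 1)) :
    face (face σ (a.succAbove i)) (i.predAbove a) = face (face σ a) i := by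
  ext x
  simp [face, Fin.succAbove_succAbove_succAbove_predAbove]

lemma face_succAbove_apply_predAbove {k : ℕ} (σ : Fin (k + 2) ↪o Fin n) (a : Fin (k + 2))
    (i : Fin (k + 1)) : face σ (a.succAbove i) (i.predAbove a) = σ a := by
  simp [face, Fin.succAbove_succAbove_predAbove]

lemma prodAt_eq_prodAt_face_mul {R : Type*} [CommRing R] (s : Fin n → R) {k : ℕ}
    (σ : Fin (k + 1) ↪o Fin n) (a : Fin (k + 1)) :
    prodAt s σ = prodAt s (face σ a) * s (σ a) := by
  rw [prodAt, Fin.prod_univ_succAbove _ a, mul_comm]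
  rfl

end Insertion

/-! ### Exactness after inverting s_j; torsion of Čech cohomology -/

section Acyclic

variable {R : Type*} [CommRing R] {n : ℕ} {s : Fin n → R}
variable {M : Type*} [AddCommGroup M] [Module R M]

/-- The type of c τ depends on τ, so equal faces are compared only after mapping to a common
localization. -/
lemma locMap_apply_congr {k : ℕ} {g : R} (c : Cochain s M k) {τ τ' : Fin k ↪o Fin n} (h : τ = τ')
    (hτ : prodAt s τ ∣ g) (hτ' : prodAt s τ' ∣ g) :
    locMap M hτ (c τ) = locMap M hτ' (c τ') := by
  subst h
  rfl

/-- The contracting homotopy of the Čech complex, when `s j` acts bijectively: up to sign,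
`h c τ` is the value of `c` at `τ ∪ {j}`. -/
lemma exists_homotopy {j : Fin n} (hj : Function.Bijective fun m : M => s j • m) {k : ℕ}
    (c : Cochain s M (k + 1)) :
    ∃ b : Cochain s M k, (∀ τ : Fin k ↪o Fin n, j ∈ Set.range τ → b τ = 0) ∧
      ∀ (σ : Fin (k + 1) ↪o Fin n) (a : Fin (k + 1)), σ a = j →
        locMap M (prodAt_face_dvd s σ a) (b (face σ a)) = (-1 : R) ^ (a : ℕ) • c σ := by
  -- Quantifying over all (σ, a) avoids choosing an insertion in the statement; uniqueness of
  -- insertion leaves just one pair to satisfy.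
  have key (τ : Fin k ↪o Fin n) : ∃ y : Loc M (prodAt s τ), (j ∈ Set.range τ → y = 0) ∧
      ∀ (σ : Fin (k + 1) ↪o Fin n) (a : Fin (k + 1)), σ a = j → face σ a = τ →
        ∀ h : prodAt s τ ∣ prodAt s σ, locMap M h y = (-1 : R) ^ (a : ℕ) • c σ := by
    by_cases hτ : j ∈ Set.range τ
    · refine ⟨0, fun _ => rfl, ?_⟩
      rintro σ a rfl rfl
      exact absurd hτ (apply_notMem_range_face σ a)
    · obtain ⟨σ, a, hσ, rfl⟩ := exists_face_eq τ hτ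
      obtain ⟨y, hy⟩ := (locMap_bijective (M := M)
        (by rw [prodAt_eq_prodAt_face_mul s σ a, hσ])
        (prodAt_face_dvd s σ a) hj).2 ((-1 : R) ^ (a : ℕ) • c σ)
      refine ⟨y, fun h => absurd h hτ, ?_⟩
      intro σ' a' hσ' hf h
      obtain ⟨rfl, rfl⟩ := eq_of_face_eq (hσ'.trans hσ.symm) hf
      exact hy
  choose b hb hb' using key
  exact ⟨b, hb, fun σ a h => hb' _ σ a h rfl _⟩

/-- If some `s j` acts bijectively on `M`, then the Čech complex of `M` is exact. -/
lemma mem_coboundaries_of_bijective {j : Fin n}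
    (hj : Function.Bijective fun m : M => s j • m) {i : ℕ} {c : Cochain s M i}
    (hc : diff s M i c = 0) : c ∈ coboundaries s M i := by
  have hinj {k : ℕ} (σ : Fin (k + 1) ↪o Fin n) (a : Fin (k + 1)) (hσ : σ a = j) :
      Function.Injective (locMap M (prodAt_face_dvd s σ a)) :=
    (locMap_bijective (by rw [prodAt_eq_prodAt_face_mul s σ a, hσ]) _ hj).1
  cases i with
  | zero =>
    change c = 0
    ext τ
    obtain ⟨σ, a, hσ, rfl⟩ := exists_face_eq τ (j := j) (by rintro ⟨x, -⟩; exact x.elim0)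
    obtain rfl : a = 0 := Subsingleton.elim (α := Fin 1) a 0
    apply hinj σ 0 hσ
    have h : diff s M 0 c σ = 0 := congrFun hc σ
    simpa [diff] using h
  | succ k =>
    obtain ⟨b, hb, hb'⟩ := exists_homotopy hj c
    refine ⟨b, ?_⟩
    ext σ
    simp only [diff, LinearMap.coe_mk, AddHom.coe_mk]
    by_cases hσ : j ∈ Set.range σ
    · obtain ⟨a, ha⟩ := hσ
      -- Only the a-th face omits j; b vanishes on the others, and the two equal signs cancel.
      rw [Finset.sum_eq_single_of_mem a (Finset.mem_univ a), hb' σ a ha, smul_smul, ← pow_add,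
        ← two_mul, pow_mul, neg_one_sq, one_pow, one_smul]
      intro i _ hi
      rw [hb, map_zero, smul_zero]
      obtain ⟨l, hl⟩ := Fin.exists_succAbove_eq hi.symm
      exact ⟨l, by rw [← ha, ← hl]; rfl⟩
    -- Now σ denotes the old tuple with j inserted. Mapping to its localization is injective, and
    -- there the claim is the cocycle identity of c at σ.
    · obtain ⟨σ, a, ha, rfl⟩ := exists_face_eq σ hσ
      apply hinj σ a ha
      have h : diff s M (k + 1) c σ = 0 := congrFun hc σ
      simp only [diff, LinearMap.coe_mk, AddHom.coe_mk] at h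
      rw [Fin.sum_univ_succAbove _ a] at h
      have hterm (i : Fin (k + 1)) : locMap M (prodAt_face_dvd s σ a) ((-1 : R) ^ (i : ℕ) •
          locMap M (prodAt_face_dvd s (face σ a) i) (b (face (face σ a) i))) =
          (-1 : R) ^ (i + i.predAbove a : ℕ) •
            locMap M (prodAt_face_dvd s σ (a.succAbove i)) (c (face σ (a.succAbove i))) := by
        have h1 := congrArg (locMap M (prodAt_face_dvd s σ (a.succAbove i)))
          (hb' (face σ (a.succAbove i)) (i.predAbove a)
            ((face_succAbove_apply_predAbove σ a i).trans ha))
        rw [locMap_locMap, map_smul] at h1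
        rw [map_smul, locMap_locMap, pow_add, mul_smul, ← h1]
        congr 1
        exact locMap_apply_congr b (face_succAbove_predAbove σ a i).symm _ _
      have hsign (i : Fin (k + 1)) : (-1 : R) ^ (i + i.predAbove a : ℕ) =
          -((-1 : R) ^ (a : ℕ) * (-1 : R) ^ (a.succAbove i : ℕ)) := by
        have h2 := Fin.neg_one_pow_succAbove_add_predAbove (R := R) a i
        have e1 : (-1 : R) ^ (a : ℕ) * (-1 : R) ^ (a : ℕ) = 1 := by
          rw [← pow_add, ← two_mul, pow_mul, neg_one_sq, one_pow]
        have e2 : (-1 : R) ^ (i : ℕ) * (-1 : R) ^ (i : ℕ) = 1 := by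
          rw [← pow_add, ← two_mul, pow_mul, neg_one_sq, one_pow]
        have e3 : (-1 : R) ^ (a.succAbove i : ℕ) * (-1 : R) ^ (a.succAbove i : ℕ) = 1 := by
          rw [← pow_add, ← two_mul, pow_mul, neg_one_sq, one_pow]
        rw [pow_add, pow_add] at h2
        rw [pow_add]
        linear_combination (-1 : R) ^ (a.succAbove i : ℕ) * (-1 : R) ^ (i : ℕ) * h2 -
          (-1 : R) ^ (i : ℕ) * (-1 : R) ^ ((i.predAbove a : Fin (k + 1)) : ℕ) * e3 -
          (-1 : R) ^ (a : ℕ) * (-1 : R) ^ (a.succAbove i : ℕ) * e2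
      rw [map_sum, Finset.sum_congr rfl fun i _ => hterm i]
      have h3 := congrArg (fun y => (-1 : R) ^ (a : ℕ) • y) h
      simp only [smul_add, smul_smul, ← pow_add, ← two_mul, pow_mul, neg_one_sq, one_pow,
        one_smul, smul_zero, Finset.smul_sum] at h3
      rw [← sub_eq_zero, ← neg_eq_zero, neg_sub, ← h3, sub_eq_add_neg, ← Finset.sum_neg_distrib]
      congr 1
      refine Finset.sum_congr rfl fun i _ => ?_
      rw [hsign, neg_smul, neg_neg, pow_add]

/-- Every class in Čech cohomology is killed by a power of each `s j`. -/
lemma exists_pow_smul_mem_coboundaries (j : Fin n) {i : ℕ} {c : Cochain s M i}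
    (hc : diff s M i c = 0) : ∃ N : ℕ, s j ^ N • c ∈ coboundaries s M i := by
  let φ := LocalizedModule.mkLinearMap (Submonoid.powers (s j)) M
  have hker {k : ℕ} (c : Cochain s M k) (h : cochainMap s φ k c = 0) :
      ∃ N : ℕ, s j ^ N • c = 0 := by
    choose N hN using fun σ =>
      exists_pow_smul_eq_zero_of_locLin_mkLinearMap (prodAt s σ) (s j) (c σ) (congrFun h σ)
    -- There are finitely many σ; the sum serves as a common upper bound for the exponents.
    refine ⟨∑ σ, N σ, funext fun σ => ?_⟩
    obtain ⟨d, hd⟩ := Nat.exists_eq_add_of_le'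
      (Finset.single_le_sum (fun _ _ => Nat.zero_le _) (Finset.mem_univ σ) : N σ ≤ ∑ σ, N σ)
    rw [Pi.smul_apply, hd, pow_add, mul_smul, hN, smul_zero, Pi.zero_apply]
  have hsurj {k : ℕ} (c : Cochain s (Loc M (s j)) k) :
      ∃ (N : ℕ) (b : Cochain s M k), cochainMap s φ k b = s j ^ N • c := by
    choose N b hb using fun σ =>
      exists_locLin_mkLinearMap_eq_pow_smul (prodAt s σ) (s j) (c σ)
    refine ⟨∑ σ, N σ, fun σ => s j ^ (∑ σ, N σ - N σ) • b σ, funext fun σ => ?_⟩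
    have hle : N σ ≤ ∑ σ, N σ :=
      Finset.single_le_sum (fun _ _ => Nat.zero_le _) (Finset.mem_univ σ)
    change locLin φ _ (s j ^ (∑ σ, N σ - N σ) • b σ) = _
    rw [map_smul, hb, smul_smul, ← pow_add, Nat.sub_add_cancel hle]
    rfl
  have hbij : Function.Bijective fun m : Loc M (s j) => s j • m :=
    (Module.End.isUnit_iff _).1 (IsLocalizedModule.map_units φ ⟨s j, Submonoid.mem_powers _⟩)
  have h0 := mem_coboundaries_of_bijective hbij (c := cochainMap s φ i c)
    (by rw [diff_cochainMap, hc, map_zero])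
  cases i with
  | zero =>
    obtain ⟨N, hN⟩ := hker c h0
    exact ⟨N, hN⟩
  | succ i =>
    obtain ⟨b, hb⟩ := h0
    obtain ⟨N, b', hb'⟩ := hsurj b
    -- One power of s_j clears the denominators of the primitive, a second one makes the identity
    -- hold before localization.
    obtain ⟨N', hN'⟩ := hker (s j ^ N • c - diff s M i b')
      (by rw [map_sub, ← diff_cochainMap, hb', map_smul, map_smul, hb, sub_self])
    refine ⟨N' + N, s j ^ N' • b', ?_⟩
    rw [map_smul, pow_add, mul_smul, ← sub_eq_zero, ← smul_sub, ← neg_sub, smul_neg, hN',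
      neg_zero]

/-- Every class in Čech cohomology is killed by a power of each element of the radical of
`(s_0, …, s_{n-1})`. -/
lemma exists_pow_smul_mem_coboundaries_of_mem_radical {x : R}
    (hx : x ∈ (Ideal.span (Set.range s)).radical) {i : ℕ} {c : Cochain s M i}
    (hc : diff s M i c = 0) : ∃ N : ℕ, x ^ N • c ∈ coboundaries s M i := by
  -- The multipliers sending c to a coboundary form an ideal, so it suffices that its radical
  -- contains each s_j.
  let A : Ideal R := (coboundaries s M i).comap (LinearMap.toSpanSingleton R _ c)
  have hA : Ideal.span (Set.range s) ≤ A.radical := by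
    rw [Ideal.span_le]
    rintro _ ⟨j, rfl⟩
    exact exists_pow_smul_mem_coboundaries j hc
  exact Ideal.radical_le_radical_iff.2 hA hx

end Acyclic

/-! ### Frobenius on cochains and the two diagram chases -/

section FrobeniusCochains

variable {R : Type*} [CommRing R] {p : ℕ} [ExpChar R p] {n : ℕ} {s : Fin n → R}
variable {M N : Type*} [AddCommGroup M] [Module R M] [AddCommGroup N] [Module R N]

lemma cohomologyFrob_mk_eq_zero_iff {e : ℕ} (φ : M →ₛₗ[iterateFrobenius R p e] N) {i : ℕ}
    (c : cocycles s M i) :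
    cohomologyFrob s φ i (Submodule.Quotient.mk c) = 0 ↔
      cochainFrob s φ i c ∈ coboundaries s N i :=
  Submodule.Quotient.mk_eq_zero ((coboundaries s N i).submoduleOf (cocycles s N i))
    (x := cocyclesFrob s φ i c)

lemma fNilpotent_iff {i : ℕ} :
    FNilpotent p s i ↔ ∀ c : Cochain s R i, diff s R i c = 0 → ∃ e : ℕ,
      cochainFrob s (iterateFrobenius R p e).toSemilinearMap i c ∈ coboundaries s R i := by
  constructor
  · intro h c hc
    obtain ⟨e, he⟩ := h (Submodule.Quotient.mk ⟨c, hc⟩)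
    exact ⟨e, (cohomologyFrob_mk_eq_zero_iff _ _).1 he⟩
  · intro h η
    obtain ⟨c, rfl⟩ := Submodule.Quotient.mk_surjective _ η
    obtain ⟨e, he⟩ := h c c.2
    exact ⟨e, (cohomologyFrob_mk_eq_zero_iff _ _).2 he⟩

lemma relFNilpotent_iff {I : Ideal R} {i : ℕ} :
    RelFNilpotent p s I i ↔ ∀ c : Cochain s (R ⧸ I) i, diff s (R ⧸ I) i c = 0 → ∃ e : ℕ,
      cochainFrob s (relFrobenius p I e) i c ∈ coboundaries s _ i := by
  constructor
  · intro h c hc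
    obtain ⟨e, he⟩ := h (Submodule.Quotient.mk ⟨c, hc⟩)
    exact ⟨e, (cohomologyFrob_mk_eq_zero_iff _ _).1 he⟩
  · intro h η
    obtain ⟨c, rfl⟩ := Submodule.Quotient.mk_surjective _ η
    obtain ⟨e, he⟩ := h c c.2
    exact ⟨e, (cohomologyFrob_mk_eq_zero_iff _ _).2 he⟩

/-- Lets the relative Frobenius be computed on lifts to R, where iterates compose. -/
lemma cochainMap_mkQ_cochainFrob (I : Ideal R) (e : ℕ) {i : ℕ} (c : Cochain s R i) :
    cochainMap s (frobeniusPower p I e).mkQ i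
        (cochainFrob s (iterateFrobenius R p e).toSemilinearMap i c) =
      cochainFrob s (relFrobenius p I e) i (cochainMap s I.mkQ i c) := by
  ext σ
  change locLin _ _ (locFrob _ _ (c σ)) = locFrob _ _ (locLin _ _ (c σ))
  generalize c σ = y
  induction y using LocalizedModule.induction_on with
  | h m a =>
    rw [locFrob_mk, locLin_mk, locLin_mk, locFrob_mk]
    rfl

lemma cochainFrob_cochainFrob (e e' : ℕ) {i : ℕ} (c : Cochain s R i) :
    cochainFrob s (iterateFrobenius R p e').toSemilinearMap i
        (cochainFrob s (iterateFrobenius R p e).toSemilinearMap i c) =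
      cochainFrob s (iterateFrobenius R p (e + e')).toSemilinearMap i c := by
  ext σ
  change locFrob _ _ (locFrob _ _ (c σ)) = locFrob _ _ (c σ)
  generalize c σ = y
  induction y using LocalizedModule.induction_on with
  | h m a =>
    rw [locFrob_mk, locFrob_mk, locFrob_mk, ← pow_mul, ← pow_add]
    congr 1
    change iterateFrobenius R p e' (iterateFrobenius R p e m) = iterateFrobenius R p (e + e') m
    rw [iterateFrobenius_def, iterateFrobenius_def, iterateFrobenius_def, ← pow_mul, ← pow_add]

lemma frobeniusPower_span_singleton (x : R) (e : ℕ) :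
    frobeniusPower p (Ideal.span {x}) e = Ideal.span {x ^ p ^ e} := by
  rw [frobeniusPower, Ideal.map_span, Set.image_singleton, iterateFrobenius_def]

/-- If `H^i(R)` and `H^{i+1}(R)` are `F`-nilpotent, so is `H^i(R/(x))` with respect to `R`,
provided that the kernel of multiplication by `x` is torsion. -/
lemma relFNilpotent_of_fNilpotent {x : R}
    (hx : ∀ r : R, x • r = 0 → ∀ j, ∃ k : ℕ, s j ^ k • r = 0) {i : ℕ}
    (h : FNilpotent p s i) (h' : FNilpotent p s (i + 1)) :
    RelFNilpotent p s (Ideal.span {x}) i := by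
  rw [fNilpotent_iff] at h h'
  rw [relFNilpotent_iff]
  intro c hc
  obtain ⟨b, rfl⟩ := cochainMap_surjective s (Submodule.mkQ_surjective (Ideal.span {x})) i c
  rw [diff_cochainMap] at hc
  -- The cocycle a represents the image of the class under the connecting map.
  obtain ⟨a, ha⟩ := exists_eq_smul_of_cochainMap_mkQ_eq_zero rfl hc
  have hda : diff s R (i + 1) a = 0 := by
    apply smul_cochain_injective hx
    rw [← map_smul, ← ha, diff_diff, smul_zero]
  obtain ⟨e, g, hg⟩ := h' a hda
  -- Subtracting x^(p^e) g makes F^e b a cocycle over R; the correction disappears in the final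
  -- quotient.
  obtain ⟨e', he'⟩ := h
    (cochainFrob s (iterateFrobenius R p e).toSemilinearMap i b - x ^ p ^ e • g) (by
      rw [map_sub, map_smul, hg, diff_cochainFrob, ha, map_smulₛₗ, iterateFrobenius_def,
        sub_self])
  refine ⟨e + e', ?_⟩
  rw [← cochainMap_mkQ_cochainFrob, ← cochainFrob_cochainFrob]
  rw [map_sub, map_smulₛₗ, iterateFrobenius_def, ← pow_mul, ← pow_add] at he'
  have hm := cochainMap_mem_coboundaries
    (frobeniusPower p (Ideal.span {x}) (e + e')).mkQ he'
  rwa [map_sub, cochainMap_mkQ_smul_eq_zero, sub_zero] at hm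
  rw [frobeniusPower_span_singleton]
  exact Ideal.mem_span_singleton_self _

/-- If the modules `H^i(R/(x^{p^e}))` are `F`-nilpotent with respect to `R`, then `H^{i+1}(R)` is
`F`-nilpotent. -/
lemma fNilpotent_succ_of_relFNilpotent (hp : 1 < p) {x : R}
    (hx : ∀ k : ℕ, ∀ r : R, x ^ k • r = 0 → ∀ j, ∃ l : ℕ, s j ^ l • r = 0)
    (hxs : x ∈ (Ideal.span (Set.range s)).radical) {i : ℕ}
    (h : ∀ e : ℕ, RelFNilpotent p s (Ideal.span {x ^ p ^ e}) i) :
    FNilpotent p s (i + 1) := by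
  rw [fNilpotent_iff]
  intro a ha
  obtain ⟨N, hN⟩ := exists_pow_smul_mem_coboundaries_of_mem_radical hxs ha
  -- The exponent N is raised to p^N, the form in which the hypothesis is available.
  obtain ⟨d, hd⟩ := Nat.exists_eq_add_of_le' (Nat.lt_pow_self hp (n := N)).le
  obtain ⟨b, hb⟩ : x ^ p ^ N • a ∈ coboundaries s R (i + 1) := by
    rw [hd, pow_add, mul_smul]
    exact Submodule.smul_mem _ _ hN
  obtain ⟨e, he⟩ := relFNilpotent_iff.1 (h N)
    (cochainMap s (Ideal.span {x ^ p ^ N}).mkQ i b) (by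
      rw [diff_cochainMap, hb,
        cochainMap_mkQ_smul_eq_zero (Ideal.mem_span_singleton_self _)])
  refine ⟨e, ?_⟩
  rw [← cochainMap_mkQ_cochainFrob] at he
  obtain ⟨w, hw, hwe⟩ := exists_mem_coboundaries_cochainMap_eq (Submodule.mkQ_surjective _) he
  rw [← sub_eq_zero, ← map_sub] at hwe
  obtain ⟨g, hg⟩ := exists_eq_smul_of_cochainMap_mkQ_eq_zero
    (frobeniusPower_span_singleton _ _) hwe
  -- Here w - F^e b = x^(p^N p^e) g with w a coboundary. Applying the differential and cancelling
  -- the power of x exhibits F^e a as the differential of -g.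
  refine ⟨-g, ?_⟩
  rw [← pow_mul] at hg
  apply smul_cochain_injective (hx (p ^ N * p ^ e))
  rw [← map_smul, smul_neg, ← hg, neg_sub, map_sub, diff_eq_zero_of_mem_coboundaries hw, sub_zero,
    diff_cochainFrob, hb, map_smulₛₗ, iterateFrobenius_def, pow_mul]

end FrobeniusCochains

/-! ### Filter regular elements and H^0 -/

section LocalRing

variable {R : Type*} [CommRing R] [IsLocalRing R]

open IsLocalRing

lemma IsFilterRegular.pow {x : R} (hx : IsFilterRegular x) {m : ℕ} (hm : 1 ≤ m) :
    IsFilterRegular (x ^ m) :=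
  ⟨Ideal.pow_mem_of_mem _ hx.1 m hm,
    fun P hP hne h => hx.2 P hP hne (hP.isPrime.mem_of_pow_mem m h)⟩

/-- Prime avoidance: were 𝔪 covered by the finitely many other associated primes, it would lie in
one and equal it. -/
lemma exists_isFilterRegular [IsNoetherianRing R] : ∃ x : R, IsFilterRegular x := by
  by_contra! hcon
  have hfin : (associatedPrimes R R \ {maximalIdeal R}).Finite :=
    (associatedPrimes.finite R R).subset Set.sdiff_subset
  have hsub : (maximalIdeal R : Set R) ⊆
      ⋃ P ∈ associatedPrimes R R \ {maximalIdeal R}, (P : Set R) := by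
    intro x hx
    have h := hcon x
    simp only [IsFilterRegular, not_and, not_forall, not_not] at h
    obtain ⟨P, hP, hne, hxP⟩ := h hx
    exact Set.mem_biUnion (⟨hP, hne⟩ : P ∈ associatedPrimes R R \ {maximalIdeal R}) hxP
  obtain ⟨P, ⟨hP, hne⟩, hle⟩ := (Ideal.subset_union_prime_finite (f := id) hfin 0 0
    fun P hP _ _ => hP.1.isPrime).1 hsub
  exact hne ((maximalIdeal.isMaximal R).eq_of_le hP.isPrime.ne_top hle).symm

/-- The kernel of multiplication by a filter regular element is `𝔪`-power torsion. -/
lemma IsFilterRegular.exists_pow_smul_eq_zero [IsNoetherianRing R] {x : R}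
    (hx : IsFilterRegular x) {r y : R} (hr : x • r = 0) (hy : y ∈ maximalIdeal R) :
    ∃ k : ℕ, y ^ k • r = 0 := by
  suffices h : y ∈ (Module.annihilator R (Submodule.span R {r})).radical by
    obtain ⟨k, hk⟩ := h
    rw [Submodule.mem_annihilator_span_singleton] at hk
    exact ⟨k, hk⟩
  -- Each minimal prime over ann(r) is associated to R and contains x, hence is 𝔪.
  rw [← Ideal.sInf_minimalPrimes, Ideal.mem_sInf]
  intro P hP
  have hxP : x ∈ P := hP.1.2 ((Submodule.mem_annihilator_span_singleton _ _).2 hr)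
  have hPa : P ∈ associatedPrimes R R :=
    associatedPrimes.subset_of_injective (Submodule.span R {r}).subtype_injective
      (Module.associatedPrimes.minimalPrimes_annihilator_subset_associatedPrimes R _ hP)
  by_cases hne : P = maximalIdeal R
  · rwa [hne]
  · exact absurd hxP (hx.2 P hPa hne)

/-- In positive dimension, `H^0(R)` consists of nilpotent elements. -/
lemma fNilpotent_zero {p : ℕ} [ExpChar R p] (hp : 1 < p) (hd : 0 < ringKrullDim R) {n : ℕ}
    {s : Fin n → R} (hs : (Ideal.span (Set.range s)).radical = maximalIdeal R) :
    FNilpotent p s 0 := by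
  rw [fNilpotent_iff]
  intro c hc
  -- The only 0-tuple is empty, with product 1, so c is just an element r of R.
  obtain ⟨σ⟩ : Nonempty (Fin 0 ↪o Fin n) := ⟨OrderEmbedding.ofStrictMono Fin.elim0 fun x => x.elim0⟩
  have hσ (τ : Fin 0 ↪o Fin n) : τ = σ := RelEmbedding.ext fun x => x.elim0
  have hone (u : Submonoid.powers (prodAt s σ)) : u = 1 := by
    obtain ⟨_, k, rfl⟩ := u
    ext
    simp [prodAt]
  obtain ⟨r, hr⟩ : ∃ r : R, c σ = LocalizedModule.mk r 1 := by
    generalize c σ = y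
    induction y using LocalizedModule.induction_on with
    | h r a => exact ⟨r, by rw [hone a]⟩
  have hkill (x : R) (hx : x ∈ maximalIdeal R) : ∃ N : ℕ, x ^ N * r = 0 := by
    rw [← hs] at hx
    obtain ⟨N, hN⟩ := exists_pow_smul_mem_coboundaries_of_mem_radical hx hc
    have h1 : x ^ N • c σ = 0 := congrFun (show x ^ N • c = 0 from hN) σ
    rw [hr, LocalizedModule.smul'_mk, mk_eq_zero_iff] at h1
    obtain ⟨u, hu⟩ := h1
    exact ⟨N, by simpa [hone u] using hu⟩
  -- If r were a unit, 𝔪 would consist of nilpotents and R would have dimension 0.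
  have hrm : r ∈ maximalIdeal R := by
    by_contra hunit
    rw [mem_maximalIdeal, mem_nonunits_iff, not_not] at hunit
    have hle : maximalIdeal R ≤ nilradical R := by
      intro x hx
      obtain ⟨N, hN⟩ := hkill x hx
      exact ⟨N, hunit.mul_left_eq_zero.1 hN⟩
    have hmax : (nilradical R).IsMaximal := by
      rw [← (maximalIdeal.isMaximal R).eq_of_le (fun h => ?_) hle]
      · infer_instance
      · exact not_isNilpotent_one (mem_nilradical.1 ((Ideal.eq_top_iff_one _).1 h))
    have := Ring.KrullDimLE.of_isMaximal_nilradical R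
    exact absurd hd (not_lt.2 ((Order.krullDimLE_iff 0 _).1 this))
  obtain ⟨N, hN⟩ := hkill r hrm
  -- `hN` says r^(N+1) = 0, and N + 1 ≤ p^(N+1).
  refine ⟨N + 1, ?_⟩
  change _ = 0
  ext τ
  rw [hσ τ]
  change locFrob _ _ (c σ) = 0
  rw [hr, locFrob_mk, mk_eq_zero_iff]
  refine ⟨1, ?_⟩
  obtain ⟨d, hd⟩ := Nat.exists_eq_add_of_le' (Nat.lt_pow_self hp (n := N + 1)).le
  change (1 : R) • iterateFrobenius R p (N + 1) r = 0
  rw [one_smul, iterateFrobenius_def, hd, pow_add, pow_succ, hN, mul_zero]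

end LocalRing

end LocalCoh

end

/-! ### The equivalences -/

theorem mainTheorem9 {R : Type*} [CommRing R] [IsLocalRing R] [IsNoetherianRing R]
    (p : ℕ) [Fact p.Prime] [CharP R p] (hd : 0 < ringKrullDim R)
    {n : ℕ} (s : Fin n → R)
    (hs : (Ideal.span (Set.range s)).radical = IsLocalRing.maximalIdeal R) (t : ℤ) :
    List.TFAE
      [∀ i : ℕ, (i : ℤ) ≤ t → LocalCoh.FNilpotent p s i,
       ∀ x : R, LocalCoh.IsFilterRegular x →
         ∀ i : ℕ, (i : ℤ) ≤ t - 1 → LocalCoh.RelFNilpotent p s (Ideal.span {x}) i,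
       ∃ x : R, LocalCoh.IsFilterRegular x ∧ ∀ m : ℕ, 1 ≤ m →
         ∀ i : ℕ, (i : ℤ) ≤ t - 1 → LocalCoh.RelFNilpotent p s (Ideal.span {x ^ m}) i,
       ∃ x : R, LocalCoh.IsFilterRegular x ∧ ∀ e : ℕ,
         ∀ i : ℕ, (i : ℤ) ≤ t - 1 → LocalCoh.RelFNilpotent p s (Ideal.span {x ^ p ^ e}) i] := by
  have hp : 1 < p := (Fact.out : p.Prime).one_lt
  have hsm (j : Fin n) : s j ∈ IsLocalRing.maximalIdeal R := by
    rw [← hs]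
    exact Ideal.le_radical (Ideal.subset_span ⟨j, rfl⟩)
  tfae_have 1 → 2 := by
    intro h x hx i hi
    exact LocalCoh.relFNilpotent_of_fNilpotent (fun r hr j => hx.exists_pow_smul_eq_zero hr (hsm j))
      (h i (by lia)) (h (i + 1) (by push_cast; lia))
  tfae_have 2 → 3 := by
    intro h
    obtain ⟨x, hx⟩ := LocalCoh.exists_isFilterRegular (R := R)
    exact ⟨x, hx, fun m hm => h _ (hx.pow hm)⟩
  tfae_have 3 → 4 := by
    rintro ⟨x, hx, h⟩
    exact ⟨x, hx, fun e => h _ (Nat.one_le_pow _ _ (by lia))⟩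
  tfae_have 4 → 1 := by
    rintro ⟨x, hx, h⟩ i hi
    cases i with
    | zero => exact LocalCoh.fNilpotent_zero hp hd hs
    | succ i =>
      refine LocalCoh.fNilpotent_succ_of_relFNilpotent hp (x := x) (fun k r hr j => ?_) (hs ▸ hx.1)
        fun e => h e i (by push_cast at hi; lia)
      -- The case k = 0 is allowed, but x^0 is not filter regular; passing to k + 1 treats all k at
      -- once.
      refine (hx.pow (m := k + 1) (by lia)).exists_pow_smul_eq_zero ?_ (hsm j)
      rw [pow_succ', mul_smul, hr, smul_zero]
  tfae_finish
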